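/- Let $\mathbb{E}/\mathbb{F}$ be an extension of finite fields of degree $m=\dim_{\mathbb{F}}(\mathbb{E})$. For $\alpha\in\mathbb{E}^n$ and an $\mathbb{F}$-basis $(\tau_1,\dots,\tau_m)$ of $\mathbb{E}$, write $\alpha=(\tau_1,\dots,\tau_m)M(\alpha)$ with $M(\alpha)$ an $m\times n$ matrix over $\mathbb{F}$; the rank support of $\alpha$ is the $\mathbb{F}$-subspace of $\mathbb{F}^n$ generated by the rows of $M(\alpha)$ (it does not depend on the basis), and the rank support $\chi(A)$ of a set $A\subseteq\mathbb{E}^n$ is the $\mathbb{F}$-subspace of $\mathbb{F}^n$ generated by the rank supports of the elements of $A$. A $k$-dimensional rank metric code of length $n\geqslant 1$ is a $k$-dimensional $\mathbb{E}$-subspace $C$ of $\mathbb{E}^n$. It is called minimal if for all one-dimensional $\mathbb{E}$-subspaces $B,D$ of $C$ with $\chi(B)\subseteq\chi(D)$ one has $\chi(B)=\chi(D)$. For $k\geqslant 2$, let $\varpi_{\mathbb{E}/\mathbb{F}}(k,1)$ be the minimum of $\dim_{\mathbb{F}}(U)$ over all $\mathbb{F}$-subspaces $U$ of $\mathbb{E}^{k}$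 that are cutting blocking sets of $\mathbb{E}^k$, i.e., such that for every $\mathbb{E}$-subspace $V$ of $\mathbb{E}^k$ of dimension $k-1$, the set $U\cap V$ generates $V$ over $\mathbb{E}$. Then, for every $k\geqslant 2$, $\varpi_{\mathbb{E}/\mathbb{F}}(k,1)$ is also the minimal length of $k$-dimensional minimal rank metric codes, and the following hold. (1) For every $k\geqslant 2$, $\varpi_{\mathbb{E}/\mathbb{F}}(k,1)\leqslant m+2k-3$. (2) If $m=3$, then for every $k\geqslant 2$, $\varpi_{\mathbb{E}/\mathbb{F}}(k,1)=2k$; that is, the minimal length of $k$-dimensional minimal rank metric codes is equal to $2k$. -/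

import Mathlib

open Module

noncomputable section

namespace RankMetric

/-- A subset `S` of a finite dimensional left vector space `L` over a division ring `R` is a
cutting `r`-blocking set of `L` if `⟨S ∩ V⟩_R = V` for every `R`-subspace `V` of `L` with
`dim V = dim L - r` (written without truncated subtraction). -/
def IsCuttingBlockingSet (R : Type*) {L : Type*} [DivisionRing R] [AddCommGroup L] [Module R L]
    (r : ℕ) (S : Set L) : Prop :=
  ∀ V : Submodule R L, finrank R V + r = finrank R L → Submodule.span R (S ∩ (V : Set L)) = V

section Codes

variable (F : Type*) {E : Type*} [Field F] [Field E] [Algebra F E]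

/-- The matrix `M(α)` over `F` with `α = (τ_1, …, τ_m) M(α)`, for a basis `τ` of `E / F`:
column `j` consists of the coordinates of `α_j`. -/
def coordMatrix {F : Type*} {E : Type*} [Field F] [Field E] [Algebra F E]
    {ι : Type*} (τ : Basis ι F E) {n : ℕ} (α : Fin n → E) : Matrix ι (Fin n) F :=
  Matrix.of fun i j => τ.repr (α j) i

/-- The rank support of a vector `α ∈ E^n`: the `F`-subspace of `F^n` generated by the rows of
`M(α)`. A basis of `E / F` is fixed here; `rsupp_eq_span` below shows that it does not matter. -/
def rsupp [FiniteDimensional F E] {n : ℕ} (α : Fin n → E) : Submodule F (Fin n → F) :=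
  Submodule.span F (Set.range (coordMatrix (finBasis F E) α).row)

theorem coordMatrix_row_mem {F : Type*} {E : Type*} [Field F] [Field E] [Algebra F E]
    {ι κ : Type*} [Fintype κ] (τ : Basis ι F E) (τ' : Basis κ F E) {n : ℕ} (α : Fin n → E)
    (i : ι) : (coordMatrix τ α).row i ∈ Submodule.span F (Set.range (coordMatrix τ' α).row) := by
  have h : (coordMatrix τ α).row i
      = ∑ l, τ.repr (τ' l) i • (coordMatrix τ' α).row l := by
    funext j
    have h2 := congrArg (fun x => τ.repr x i) (τ'.sum_repr (α j))
    simp only [map_sum, map_smul, Finsupp.coe_finsetSum, Finset.sum_apply, Finsupp.smul_apply,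
      smul_eq_mul] at h2
    simp only [coordMatrix, Matrix.row, Matrix.of_apply, Finset.sum_apply, Pi.smul_apply,
      smul_eq_mul]
    rw [← h2]
    exact Finset.sum_congr rfl fun l _ => mul_comm _ _
  rw [h]
  exact Submodule.sum_mem _ fun l _ =>
    Submodule.smul_mem _ _ (Submodule.subset_span (Set.mem_range_self l))

/-- The rank support is independent of the choice of the basis. -/
theorem rsupp_eq_span [FiniteDimensional F E] {ι : Type*} [Fintype ι] (τ : Basis ι F E) {n : ℕ}
    (α : Fin n → E) :
    rsupp F α = Submodule.span F (Set.range (coordMatrix τ α).row) := by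
  apply le_antisymm
  · refine Submodule.span_le.2 ?_
    rintro _ ⟨i, rfl⟩
    exact coordMatrix_row_mem _ _ _ _
  · refine Submodule.span_le.2 ?_
    rintro _ ⟨i, rfl⟩
    exact coordMatrix_row_mem _ _ _ _

/-- The rank support `χ(A)` of a subset `A` of `E^n`: the `F`-subspace of `F^n` generated by the
rank supports of the elements of `A`. -/
def rankSupport [FiniteDimensional F E] {n : ℕ} (A : Set (Fin n → E)) :
    Submodule F (Fin n → F) :=
  Submodule.span F (⋃ α ∈ A, (rsupp F α : Set (Fin n → F)))

/-- `D` is rank minimal in `C`: every subcode `B` of `C` of the same dimension as `D` whose rank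
support is contained in that of `D` has the same rank support as `D`. -/
def IsRankMinimal [FiniteDimensional F E] {n : ℕ} (C D : Submodule E (Fin n → E)) : Prop :=
  ∀ B : Submodule E (Fin n → E), B ≤ C → finrank E B = finrank E D →
    rankSupport F (B : Set (Fin n → E)) ≤ rankSupport F (D : Set (Fin n → E)) →
    rankSupport F (B : Set (Fin n → E)) = rankSupport F (D : Set (Fin n → E))

/-- The rank metric code `C ≤ E^n` is `r`-minimal: each of its `r`-dimensional subcodes is rank
minimal in `C`. It is called minimal if it is `1`-minimal. -/
def IsMinimalCode [FiniteDimensional F E] (r : ℕ) {n : ℕ} (C : Submodule E (Fin n → E)) : Prop :=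
  ∀ D : Submodule E (Fin n → E), D ≤ C → finrank E D = r → IsRankMinimal F C D

end Codes

section Minimum

variable (F E : Type*) [Field F] [Field E] [Algebra F E]

/-- The lengths `n ≥ 1` of the `k`-dimensional `r`-minimal rank metric codes over `E / F`. -/
def minimalCodeLengths [FiniteDimensional F E] (k r : ℕ) : Set ℕ :=
  {n | 0 < n ∧ ∃ C : Submodule E (Fin n → E), finrank E C = k ∧ IsMinimalCode F r C}

/-- The `F`-dimensions of the `F`-subspaces of `E^k` that are cutting `r`-blocking sets. -/
def cuttingDims (k r : ℕ) : Set ℕ :=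
  {d | ∃ U : Submodule F (Fin k → E),
    IsCuttingBlockingSet E r (U : Set (Fin k → E)) ∧ finrank F U = d}

/-- `ϖ_{E/F}(k, r)`: the minimal `F`-dimension of an `F`-subspace of `E^k` that is a cutting
`r`-blocking set of `E^k`. -/
def varpi (k r : ℕ) : ℕ := sInf (cuttingDims F E k r)

/-- The minimum in the definition of `varpi` is attained. -/
theorem varpi_isLeast (k r : ℕ) : IsLeast (cuttingDims F E k r) (varpi F E k r) := by
  have hne : (cuttingDims F E k r).Nonempty := by
    refine ⟨_, ⊤, fun V _ => ?_, rfl⟩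
    simp
  exact ⟨Nat.sInf_mem hne, fun d hd => Nat.sInf_le hd⟩

end Minimum

end RankMetric

end

/-! Codes and cutting subspaces correspond. Evaluating all functionals at an `F`-basis of a cutting
subspace `U` gives a code of length `dim U`. The `F`-relations between the entries of the word of
`f` are the trace of `ker f` on `U`, and rank supports are the orthogonals of these relations, so
cutting gives minimality. Conversely, the coordinate functionals of a minimal code span a cutting
subspace of its dual.

The upper bound is a count. If `U` is not cutting, some independent functionals satisfy `g = L ∘ f`
on `U` with `L` an `F`-linear endomorphism of `E`. Let `Q = |E|`. There are at most `Q^(2k+m)`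
triples `(f, g, L)`, each defining a subspace of size `Q^(k-1)`, and a bad tuple lies in the
subspaces of at least `2Q(Q-1)^2` triples. If all tuples of length `m + 2k - 3` were bad, then
`2(Q-1)^2 ≤ Q^2`, which is false for `Q ≥ 4`.

For `m = 3` the lower bound is an induction on the dimension, projecting from a point of `U`. In
dimension 2 a cutting subspace has dimension greater than `m`. In the inductive step, a `U` just
below the bound is so large that some `E`-line meets it in `F`-dimension at least 2, and projecting
from that line loses two dimensions. -/

namespace RankMetric

/-! ### Cutting blocking sets and hyperplanes. -/

section Cutting

variable {F E : Type*} [Field F] [Field E] [Algebra F E]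
variable {X Y : Type*} [AddCommGroup X] [Module E X] [Module F X] [IsScalarTower F E X]
  [AddCommGroup Y] [Module E Y] [Module F Y] [IsScalarTower F E Y]

theorem finrank_comap_add [FiniteDimensional E X] {π : X →ₗ[E] Y}
    (hπ : Function.Surjective π) (V : Submodule E Y) {r : ℕ}
    (hV : finrank E V + r = finrank E Y) :
    finrank E (V.comap π) + r = finrank E X := by
  have : FiniteDimensional E Y := Module.Finite.of_surjective π hπ
  have h1 := (V.mkQ ∘ₗ π).finrank_range_add_finrank_ker
  have h2 : LinearMap.range (V.mkQ ∘ₗ π) = ⊤ :=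
    LinearMap.range_eq_top.2 ((Submodule.mkQ_surjective V).comp hπ)
  have h3 : LinearMap.ker (V.mkQ ∘ₗ π) = V.comap π := by
    rw [LinearMap.ker_comp, Submodule.ker_mkQ]
  rw [h2, h3, finrank_top] at h1
  have h4 := V.finrank_quotient_add_finrank
  omega

/-- The image of a cutting blocking set under a surjective linear map is cutting. -/
theorem IsCuttingBlockingSet.image [FiniteDimensional E X] {r : ℕ} {S : Set X}
    (hS : IsCuttingBlockingSet E r S) {π : X →ₗ[E] Y} (hπ : Function.Surjective π) :
    IsCuttingBlockingSet E r (π '' S) := by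
  intro V hV
  have h := hS (V.comap π) (finrank_comap_add hπ V hV)
  apply le_antisymm
  · exact Submodule.span_le.2 Set.inter_subset_right
  · have h2 := congrArg (Submodule.map π) h
    rw [Submodule.map_comap_eq_of_surjective hπ, Submodule.map_span] at h2
    refine h2.ge.trans (Submodule.span_mono ?_)
    rintro _ ⟨x, ⟨hx, hxV⟩, rfl⟩
    exact ⟨⟨x, hx, rfl⟩, hxV⟩

theorem finrank_ker_add_one [FiniteDimensional E X] {f : Dual E X} (hf : f ≠ 0) :
    finrank E (LinearMap.ker f) + 1 = finrank E X := by
  have := Module.Dual.finrank_ker_add_one_of_ne_zero hf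
  exact this

/-- If `S` is not a cutting blocking set, the vanishing on `S` of some functional forces that of
an independent one. -/
theorem exists_linearIndependent_of_not_cutting [FiniteDimensional E X] {S : Set X}
    (hS : ¬ IsCuttingBlockingSet E 1 S) :
    ∃ f g : Dual E X, LinearIndependent E ![f, g] ∧ ∀ u ∈ S, f u = 0 → g u = 0 := by
  unfold IsCuttingBlockingSet at hS
  push Not at hS
  obtain ⟨V, hV, hne⟩ := hS
  have hle : Submodule.span E (S ∩ (V : Set X)) ≤ V := Submodule.span_le.2 Set.inter_subset_right
  have hVtop : V < ⊤ := by
    refine lt_top_iff_ne_top.2 fun h => ?_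
    rw [h, finrank_top] at hV
    omega
  obtain ⟨f, hf, hVf⟩ := V.exists_le_ker_of_lt_top hVtop
  have hVeq : V = LinearMap.ker f := by
    apply Submodule.eq_of_le_of_finrank_eq hVf
    have := finrank_ker_add_one hf
    omega
  -- Some `v` in `ker f` escapes the span of the trace; a functional killing this span but not `v`
  -- is independent of `f`.
  obtain ⟨v, hvV, hv⟩ := SetLike.exists_of_lt (lt_of_le_of_ne hle hne)
  obtain ⟨g, hgv, hg⟩ := Submodule.exists_le_ker_of_notMem hv
  have hfv : f v = 0 := hVf hvV
  refine ⟨f, g, LinearIndependent.pair_iff.2 fun s t hst => ?_, fun u hu hfu => ?_⟩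
  · have ht : t = 0 := by
      have := LinearMap.congr_fun hst v
      simpa [hfv, hgv] using this
    subst ht
    simpa [hf] using hst
  · refine hg (Submodule.subset_span ⟨hu, ?_⟩)
    rw [hVeq]
    exact hfu

/-- A cutting blocking set is not annihilated by a nonzero functional, in dimension at least 2. -/
theorem IsCuttingBlockingSet.exists_ne_zero [FiniteDimensional E X] (hX : 2 ≤ finrank E X)
    {S : Set X} (hS : IsCuttingBlockingSet E 1 S) {f : Dual E X} (hf : f ≠ 0) :
    ∃ u ∈ S, f u ≠ 0 := by
  by_contra! h
  obtain ⟨v, hv⟩ : ∃ v, f v ≠ 0 := by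
    by_contra! h0
    exact hf (LinearMap.ext h0)
  have hv0 : v ≠ 0 := by
    rintro rfl
    simp at hv
  -- In dimension at least 2, `v` lies on a hyperplane. The points of `S` generate it and are killed
  -- by `f`, which forces `f v = 0`.
  have hne : Submodule.span E {v} < ⊤ := by
    refine lt_top_iff_ne_top.2 fun h1 => ?_
    have := finrank_span_singleton (K := E) hv0
    rw [h1, finrank_top] at this
    omega
  obtain ⟨g, hg, hgv⟩ := Submodule.exists_le_ker_of_lt_top _ hne
  have hs := hS (LinearMap.ker g) (finrank_ker_add_one hg)
  have hle : LinearMap.ker g ≤ LinearMap.ker f := by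
    rw [← hs]
    exact Submodule.span_le.2 fun u hu => h u hu.1
  exact hv (hle (hgv (Submodule.mem_span_singleton_self v)))

/-- For a cutting blocking set, an inclusion between the traces of two hyperplanes forces the
equality of the hyperplanes. -/
theorem IsCuttingBlockingSet.ker_eq [FiniteDimensional E X] {S : Set X}
    (hS : IsCuttingBlockingSet E 1 S) {f g : Dual E X} (hf : f ≠ 0) (hg : g ≠ 0)
    (h : ∀ u ∈ S, f u = 0 → g u = 0) : LinearMap.ker f = LinearMap.ker g := by
  have hs := hS (LinearMap.ker f) (finrank_ker_add_one hf)
  have hle : LinearMap.ker f ≤ LinearMap.ker g := by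
    rw [← hs]
    exact Submodule.span_le.2 fun u hu => h u hu.1 hu.2
  apply Submodule.eq_of_le_of_finrank_eq hle
  have h1 := finrank_ker_add_one hf
  have h2 := finrank_ker_add_one hg
  omega

/-- A linear map on a subspace factors through another one with a smaller kernel. -/
theorem exists_comp_eq_on {K A B D : Type*} [Field K] [AddCommGroup A] [Module K A]
    [AddCommGroup B] [Module K B] [AddCommGroup D] [Module K D] (U : Submodule K A)
    (a : A →ₗ[K] B) (b : A →ₗ[K] D) (h : ∀ u ∈ U, a u = 0 → b u = 0) :
    ∃ L : B →ₗ[K] D, ∀ u ∈ U, b u = L (a u) := by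
  have hk : LinearMap.ker (a.domRestrict U) ≤ LinearMap.ker (b.domRestrict U) :=
    fun u hu => h u u.2 hu
  obtain ⟨L, hL⟩ := LinearMap.exists_extend
    ((Submodule.liftQ _ (b.domRestrict U) hk) ∘ₗ
      (a.domRestrict U).quotKerEquivRange.symm.toLinearMap)
  refine ⟨L, fun u hu => ?_⟩
  have h1 := LinearMap.congr_fun hL ⟨a u, ⟨⟨u, hu⟩, rfl⟩⟩
  have h2 : (a.domRestrict U).quotKerEquivRange.symm ⟨a u, ⟨⟨u, hu⟩, rfl⟩⟩
      = Submodule.Quotient.mk ⟨u, hu⟩ := by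
    rw [LinearEquiv.symm_apply_eq]
    rfl
  simp only [LinearMap.comp_apply, LinearEquiv.coe_coe, h2, Submodule.liftQ_apply] at h1
  exact h1.symm

end Cutting

/-! ### The upper bound by double counting. -/

section Counting

variable {F E : Type*} [Field F] [Field E] [Algebra F E]
variable {X : Type*} [AddCommGroup X] [Module E X] [Module F X] [IsScalarTower F E X]

/-- The vectors on which `g` is `L ∘ f`. -/
def graphSubmodule (f g : Dual E X) (L : E →ₗ[F] E) : Submodule F X :=
  LinearMap.ker (g.restrictScalars F - L ∘ₗ f.restrictScalars F)

theorem mem_graphSubmodule {f g : Dual E X} {L : E →ₗ[F] E} {u : X} :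
    u ∈ graphSubmodule f g L ↔ g u = L (f u) := by
  simp [graphSubmodule, sub_eq_zero]

theorem exists_apply_eq_zero_of_linearIndependent {f g : Dual E X}
    (h : LinearIndependent E ![f, g]) : ∃ v, f v = 0 ∧ g v ≠ 0 := by
  by_contra! h0
  have hf : f ≠ 0 := h.ne_zero 0
  obtain ⟨w, hw⟩ : ∃ w, f w ≠ 0 := by
    by_contra! h1
    exact hf (LinearMap.ext h1)
  have h2 : g w • f + (-f w) • g = 0 := by
    ext x
    have := h0 (x - (f x / f w) • w) (by simp [hw])
    simp only [map_sub, map_smul, smul_eq_mul] at this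
    simp only [LinearMap.add_apply, LinearMap.smul_apply, smul_eq_mul, LinearMap.zero_apply]
    field_simp at this
    linear_combination -this
  have := (LinearIndependent.pair_iff.1 h _ _ h2).2
  exact hw (neg_eq_zero.1 this)

/-- On the `E`-line of a vector killed by `f` but not by `g`, the map `g - L ∘ f` already takes
every value, so its kernel has index `|E|`. -/
theorem card_graphSubmodule_mul {f g : Dual E X} (h : LinearIndependent E ![f, g])
    (L : E →ₗ[F] E) : Nat.card (graphSubmodule f g L) * Nat.card E = Nat.card X := by
  obtain ⟨v, hfv, hgv⟩ := exists_apply_eq_zero_of_linearIndependent h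
  have hs : Function.Surjective (g.restrictScalars F - L ∘ₗ f.restrictScalars F) := by
    intro y
    refine ⟨(y / g v) • v, ?_⟩
    simp [hfv, hgv]
  rw [Submodule.card_eq_card_quotient_mul_card (graphSubmodule f g L)]
  congr 1
  exact (Nat.card_congr (LinearMap.quotKerEquivOfSurjective _ hs).toEquiv).symm

/-- Some translate of an `F`-linear endomorphism of a finite field `E` by a multiplication is
invertible. -/
theorem exists_add_smul_id_bijective [Finite E] (L : E →ₗ[F] E) :
    ∃ e : E, Function.Bijective (L + LinearMap.mulLeft F e) := by
  have : Fintype E := Fintype.ofFinite E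
  classical
  -- There are fewer units than elements, so some `e` is not of the form `-L x / x`; then `L x + e
  -- x` vanishes only at `0`.
  have hns : ¬ Function.Surjective (fun x : Eˣ => -L x / (x : E)) := by
    intro h
    have h1 := Fintype.card_le_of_surjective _ h
    rw [Fintype.card_units] at h1
    have := Fintype.card_pos (α := E)
    omega
  unfold Function.Surjective at hns
  push Not at hns
  obtain ⟨e, he⟩ := hns
  refine ⟨e, Finite.injective_iff_bijective.1 ((injective_iff_map_eq_zero _).2 fun x hx => ?_)⟩
  by_contra hx0
  refine he (Units.mk0 x hx0) ?_
  simp only [LinearMap.add_apply, LinearMap.mulLeft_apply] at hx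
  rw [Units.val_mk0, div_eq_iff hx0]
  linear_combination -hx

/-- The substitution `(f, g) ↦ (c f, d (g + e f))`. -/
def moveFst (c : Eˣ) (f : Dual E X) : Dual E X := (c : E) • f

/-- The substitution `(f, g) ↦ (c f, d (g + e f))`. -/
def moveSnd (d : Eˣ) (e : E) (f g : Dual E X) : Dual E X := (d : E) • (g + e • f)

/-- The linear map `L` after the substitution `(f, g) ↦ (c f, d (g + e f))`. -/
def moveMap (c d : Eˣ) (e : E) (L : E →ₗ[F] E) : E →ₗ[F] E :=
  LinearMap.mulLeft F (d : E) ∘ₗ (L + LinearMap.mulLeft F e) ∘ₗ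
    LinearMap.mulLeft F ((c⁻¹ : Eˣ) : E)

theorem linearIndependent_move {f g : Dual E X} (h : LinearIndependent E ![f, g]) (c d : Eˣ)
    (e : E) : LinearIndependent E ![moveFst c f, moveSnd d e f g] := by
  rw [LinearIndependent.pair_iff] at h ⊢
  intro s t hst
  have := h (s * c + t * d * e) (t * d) (by
    rw [← hst, moveFst, moveSnd]
    module)
  have ht : t = 0 := by simpa using this.2
  refine ⟨?_, ht⟩
  simpa [ht] using this.1

theorem mem_graphSubmodule_move {f g : Dual E X} {L : E →ₗ[F] E} {u : X}
    (hu : u ∈ graphSubmodule f g L) (c d : Eˣ) (e : E) :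
    u ∈ graphSubmodule (moveFst c f) (moveSnd d e f g) (moveMap c d e L) := by
  rw [mem_graphSubmodule] at hu ⊢
  simp [moveFst, moveSnd, moveMap, hu, mul_add]

/-- The functionals alone separate the substitutions, so one triple yields `|E| (|E| - 1)^2`
distinct ones. -/
theorem move_injective {f g : Dual E X} (h : LinearIndependent E ![f, g]) {c d c' d' : Eˣ}
    {e e' : E} (h1 : moveFst c f = moveFst c' f) (h2 : moveSnd d e f g = moveSnd d' e' f g) :
    c = c' ∧ d = d' ∧ e = e' := by
  rw [LinearIndependent.pair_iff] at h
  have hc := (h (c - c') 0 (by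
    rw [sub_smul, zero_smul, add_zero]
    exact sub_eq_zero.2 h1)).1
  have hd := h (d * e - d' * e') (d - d') (by
    rw [moveSnd, moveSnd, ← sub_eq_zero] at h2
    rw [← h2]
    module)
  have hd2 : (d : E) = d' := sub_eq_zero.1 hd.2
  refine ⟨Units.ext (sub_eq_zero.1 hc), Units.ext hd2, ?_⟩
  have := hd.1
  rw [← hd2, ← mul_sub] at this
  simpa [sub_eq_zero] using this

variable (F E X) in
/-- The triples `(f, g, L)` with independent functionals `f`, `g`. -/
abbrev GraphTriple : Type _ :=
  {t : Dual E X × Dual E X × (E →ₗ[F] E) // LinearIndependent E ![t.1, t.2.1]}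

/-- If `S` lies in one of the subspaces `g = L ∘ f`, then it does so for many triples. -/
theorem le_card_graphTriple [Finite E] [Finite X] {S : Set X} (t₀ : GraphTriple F E X)
    (h₀ : S ⊆ graphSubmodule t₀.1.1 t₀.1.2.1 t₀.1.2.2) :
    2 * (Nat.card E * (Nat.card E - 1) ^ 2) ≤
      Nat.card {t : GraphTriple F E X // S ⊆ graphSubmodule t.1.1 t.1.2.1 t.1.2.2} := by
  obtain ⟨⟨f, g, L⟩, hfg⟩ := t₀
  simp only at h₀ hfg
  -- Once `L + e₀` is invertible, `g₁ = g + e₀ f` and `f` can exchange roles: `f = M⁻¹ ∘ g₁` on `S`.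
  -- This second family gives the factor 2.
  obtain ⟨e₀, he₀⟩ := exists_add_smul_id_bijective L
  set M := LinearEquiv.ofBijective _ he₀ with hM
  set g₁ := g + e₀ • f with hg₁
  have hind : LinearIndependent E ![g₁, f] := by
    rw [LinearIndependent.pair_symm_iff]
    have := linearIndependent_move hfg 1 1 e₀
    simpa [moveFst, moveSnd] using this
  have hS : S ⊆ graphSubmodule g₁ f (M.symm : E →ₗ[F] E) := by
    intro u hu
    have h1 := mem_graphSubmodule.1 (h₀ hu)
    refine mem_graphSubmodule.2 ?_
    rw [LinearEquiv.coe_coe, LinearEquiv.eq_symm_apply, hM, LinearEquiv.ofBijective_apply]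
    simp [hg₁, h1]
  let P := {t : GraphTriple F E X // S ⊆ graphSubmodule t.1.1 t.1.2.1 t.1.2.2}
  let φ : (Eˣ × Eˣ × E) ⊕ (Eˣ × Eˣ × E) → P := Sum.elim
    (fun p => ⟨⟨(moveFst p.1 f, moveSnd p.2.1 p.2.2 f g, moveMap p.1 p.2.1 p.2.2 L),
      linearIndependent_move hfg _ _ _⟩, fun u hu => mem_graphSubmodule_move (h₀ hu) _ _ _⟩)
    (fun p => ⟨⟨(moveFst p.1 g₁, moveSnd p.2.1 p.2.2 g₁ f, moveMap p.1 p.2.1 p.2.2 M.symm),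
      linearIndependent_move hind _ _ _⟩, fun u hu => mem_graphSubmodule_move (hS hu) _ _ _⟩)
  -- The two families are disjoint: their first functionals are nonzero multiples of independent
  -- ones.
  have hne : ∀ c c' : Eˣ, moveFst c f ≠ moveFst c' g₁ := by
    intro c c' h
    have := (LinearIndependent.pair_iff.1 hind (-c') c (by
      simp only [moveFst] at h
      rw [h]
      module)).2
    exact c.ne_zero this
  have hφ : Function.Injective φ := by
    rintro (⟨c, d, e⟩ | ⟨c, d, e⟩) (⟨c', d', e'⟩ | ⟨c', d', e'⟩) h <;>
    · have h1 := congrArg (fun t : P => t.1.1.1) h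
      have h2 := congrArg (fun t : P => t.1.1.2.1) h
      simp only [φ, Sum.elim_inl, Sum.elim_inr] at h1 h2
      first
      | obtain ⟨rfl, rfl, rfl⟩ := move_injective hfg h1 h2
        rfl
      | obtain ⟨rfl, rfl, rfl⟩ := move_injective hind h1 h2
        rfl
      | exact absurd h1 (hne _ _)
      | exact absurd h1.symm (hne _ _)
  have : Finite (Dual E X) := DFunLike.finite _
  have : Finite (E →ₗ[F] E) := DFunLike.finite _
  have hcard := Nat.card_le_card_of_injective φ hφ
  rw [Nat.card_sum, Nat.card_prod, Nat.card_prod, Nat.card_units] at hcard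
  refine le_trans (le_of_eq ?_) hcard
  ring

/-- There are short tuples which span a cutting blocking set. -/
theorem exists_isCuttingBlockingSet_span [FiniteDimensional F E] [Finite E]
    [FiniteDimensional E X] (hm : 2 ≤ finrank F E) (hk : 2 ≤ finrank E X) :
    ∃ u : Fin (finrank F E + 2 * finrank E X - 3) → X,
      IsCuttingBlockingSet E 1 (Submodule.span F (Set.range u) : Set X) := by
  classical
  by_contra! hall
  have : Finite X := Module.finite_of_finite E
  have : Finite F := Finite.of_injective _ (algebraMap F E).injective
  have : Finite (Dual E X) := DFunLike.finite _
  have : Finite (E →ₗ[F] E) := DFunLike.finite _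
  set m := finrank F E with hmdef
  set k := finrank E X with hkdef
  set n := m + 2 * k - 3 with hn
  set Q := Nat.card E with hQ
  have hQX : Nat.card X = Q ^ k := by
    rw [hQ, hkdef, Module.natCard_eq_pow_finrank (K := E)]
  have hQD : Nat.card (Dual E X) = Q ^ k := by
    rw [Module.natCard_eq_pow_finrank (K := E), Subspace.dual_finrank_eq]
  have hQF : Q = Nat.card F ^ m := Module.natCard_eq_pow_finrank (K := F)
  have hQL : Nat.card (E →ₗ[F] E) = Q ^ m := by
    rw [Module.natCard_eq_pow_finrank (K := F), Module.finrank_linearMap, hQF, ← pow_mul]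
  -- The final contradiction needs this: `2(Q-1)^2 ≤ Q^2` still holds for `Q = 3`.
  have hQ4 : 4 ≤ Q := by
    have h2 : 2 ≤ Nat.card F := Finite.one_lt_card
    calc 4 = 2 ^ 2 := rfl
      _ ≤ Nat.card F ^ 2 := Nat.pow_le_pow_left h2 2
      _ ≤ Nat.card F ^ m := Nat.pow_le_pow_right (by omega) hm
      _ = Q := hQF.symm
  -- The incidences between tuples and triples, bounded below by summing over tuples and above by
  -- summing over triples.
  let Z := {p : (Fin n → X) × GraphTriple F E X //
    ∀ i, p.1 i ∈ graphSubmodule p.2.1.1 p.2.1.2.1 p.2.1.2.2}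
  have hZ1 : Nat.card (Fin n → X) * (2 * (Q * (Q - 1) ^ 2)) ≤ Nat.card Z := by
    let e : Z ≃ Σ u : Fin n → X, {t : GraphTriple F E X //
        Set.range u ⊆ graphSubmodule t.1.1 t.1.2.1 t.1.2.2} :=
      { toFun := fun p => ⟨p.1.1, p.1.2, Set.range_subset_iff.2 p.2⟩
        invFun := fun p => ⟨(p.1, p.2.1), Set.range_subset_iff.1 p.2.2⟩
        left_inv := fun _ => rfl
        right_inv := fun _ => rfl }
    have : Fintype (Fin n → X) := Fintype.ofFinite _
    rw [Nat.card_congr e, Nat.card_sigma, Nat.card_eq_fintype_card, ← smul_eq_mul,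
      ← Finset.card_univ]
    refine Finset.card_nsmul_le_sum _ _ _ fun u _ => ?_
    obtain ⟨f, g, hfg, h⟩ := exists_linearIndependent_of_not_cutting (hall u)
    obtain ⟨L, hL⟩ := exists_comp_eq_on (Submodule.span F (Set.range u)) (f.restrictScalars F)
      (g.restrictScalars F) h
    exact le_card_graphTriple ⟨(f, g, L), hfg⟩ fun v hv =>
      mem_graphSubmodule.2 (hL v (Submodule.subset_span hv))
  have hZ2 : Nat.card Z ≤ Nat.card (GraphTriple F E X) * (Q ^ (k - 1)) ^ n := by
    let e : Z ≃ Σ t : GraphTriple F E X, (Fin n → graphSubmodule t.1.1 t.1.2.1 t.1.2.2) :=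
      { toFun := fun p => ⟨p.1.2, fun i => ⟨p.1.1 i, p.2 i⟩⟩
        invFun := fun p => ⟨(fun i => p.2 i, p.1), fun i => (p.2 i).2⟩
        left_inv := fun _ => rfl
        right_inv := fun _ => rfl }
    have : Fintype (GraphTriple F E X) := Fintype.ofFinite _
    rw [Nat.card_congr e, Nat.card_sigma, Nat.card_eq_fintype_card (α := GraphTriple F E X),
      ← smul_eq_mul, ← Finset.card_univ]
    refine Finset.sum_le_card_nsmul _ _ _ fun t _ => ?_
    rw [Nat.card_fun, Nat.card_fin]
    refine Nat.pow_le_pow_left (le_of_eq ?_) n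
    have h1 := card_graphSubmodule_mul (F := F) t.2 t.1.2.2
    rw [hQX, ← hQ, show k = k - 1 + 1 by omega, pow_succ] at h1
    exact Nat.eq_of_mul_eq_mul_right (by omega) h1
  have hG : Nat.card (GraphTriple F E X) ≤ Q ^ k * (Q ^ k * Q ^ m) := by
    refine (Nat.card_le_card_of_injective _ Subtype.val_injective).trans ?_
    rw [Nat.card_prod, Nat.card_prod, hQD, hQL]
  rw [Nat.card_fun, Nat.card_fin, hQX] at hZ1
  have h := hZ1.trans (hZ2.trans (Nat.mul_le_mul_right _ hG))
  -- Since `2k + m = n + 3`, a common factor cancels and leaves `2(Q-1)^2 ≤ Q^2`.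
  have e1 : (Q ^ k) ^ n * (2 * (Q * (Q - 1) ^ 2))
      = ((Q ^ (k - 1)) ^ n * Q ^ (n + 1)) * (2 * (Q - 1) ^ 2) := by
    rw [show Q ^ k = Q ^ (k - 1) * Q by rw [← pow_succ]; congr 1; omega, mul_pow]
    ring
  have e2 : Q ^ k * (Q ^ k * Q ^ m) * (Q ^ (k - 1)) ^ n
      = ((Q ^ (k - 1)) ^ n * Q ^ (n + 1)) * Q ^ 2 := by
    have : Q ^ k * (Q ^ k * Q ^ m) = Q ^ (n + 1) * Q ^ 2 := by
      rw [← pow_add, ← pow_add, ← pow_add]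
      congr 1
      omega
    rw [this]
    ring
  rw [e1, e2] at h
  have h3 := Nat.le_of_mul_le_mul_left h (by positivity)
  obtain ⟨r, hr⟩ : ∃ r, Q = r + 4 := ⟨Q - 4, by omega⟩
  rw [hr, show r + 4 - 1 = r + 3 by omega] at h3
  nlinarith

end Counting

/-! ### The lower bound for cubic extensions. -/

section Cubic

variable {F E : Type*} [Field F] [Field E] [Algebra F E]

/-- An `F`-subspace of dimension at most `[E : F]` misses a point of the projective line. -/
theorem finrank_lt_of_isCutting_of_finrank_eq_two [FiniteDimensional F E] [Finite E]
    {X : Type*} [AddCommGroup X] [Module E X] [Module F X] [IsScalarTower F E X]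
    (hX : finrank E X = 2) {U : Submodule F X}
    (hU : IsCuttingBlockingSet E 1 (U : Set X)) : finrank F E < finrank F U := by
  by_contra! hle
  have : FiniteDimensional E X := FiniteDimensional.of_finrank_pos (by omega)
  have : Finite X := Module.finite_of_finite E
  have : Finite F := Finite.of_injective _ (algebraMap F E).injective
  -- Cutting means that `U` meets every `E`-line of the plane nontrivially, so `φ` is onto. If `dim
  -- U ≤ [E : F]`, cardinalities make it injective, yet it kills every `(0, u)`.
  let φ : E × U → X := fun p => p.1 • (p.2 : X)
  have hsurj : Function.Surjective φ := by
    intro x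
    rcases eq_or_ne x 0 with rfl | hx
    · exact ⟨0, by simp [φ]⟩
    · have h := hU (Submodule.span E {x}) (by rw [finrank_span_singleton hx, hX])
      by_contra hne
      have hemp : Submodule.span E ((U : Set X) ∩ (Submodule.span E {x} : Submodule E X)) ≤ ⊥ := by
        refine Submodule.span_le.2 ?_
        rintro u ⟨hu, hux⟩
        obtain ⟨c, rfl⟩ := Submodule.mem_span_singleton.1 hux
        rcases eq_or_ne c 0 with rfl | hc
        · simp
        · exact absurd ⟨(c⁻¹, ⟨c • x, hu⟩), by simp [φ, smul_smul, hc]⟩ hne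
      rw [h] at hemp
      exact hx (by simpa using hemp (Submodule.mem_span_singleton_self x))
  have hU0 : U ≠ ⊥ := by
    rintro rfl
    have : Nontrivial X := Module.nontrivial_of_finrank_pos (R := E) (by omega)
    obtain ⟨x, hx⟩ := exists_ne (0 : X)
    obtain ⟨⟨c, u, hu⟩, h⟩ := hsurj x
    rw [Submodule.mem_bot] at hu
    exact hx (by simp [← h, φ, hu])
  obtain ⟨u, hu, hu0⟩ := Submodule.exists_mem_ne_zero_of_ne_bot hU0
  have hcard : Nat.card (E × U) ≤ Nat.card X := by
    rw [Nat.card_prod, Module.natCard_eq_pow_finrank (K := E) (V := X), hX, sq]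
    refine Nat.mul_le_mul_left _ ?_
    rw [Module.natCard_eq_pow_finrank (K := F) (V := U),
      Module.natCard_eq_pow_finrank (K := F) (V := E)]
    exact Nat.pow_le_pow_right Nat.card_pos hle
  have hinj : Function.Injective φ :=
    ((Nat.bijective_iff_surjective_and_card φ).2
      ⟨hsurj, le_antisymm hcard (Nat.card_le_card_of_surjective φ hsurj)⟩).1
  have := @hinj (0, ⟨u, hu⟩) (0, 0) (by simp [φ])
  exact hu0 (by simpa using this)

/-- A subspace of more than half the dimension contains `u` and `l u` for some `u ≠ 0`. -/
theorem exists_mem_smul_mem {X : Type*} [AddCommGroup X] [Module E X] [Module F X]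
    [IsScalarTower F E X] [FiniteDimensional F X] {U : Submodule F X}
    (hU : finrank F X < 2 * finrank F U) {l : E} (hl : l ≠ 0) :
    ∃ u ∈ U, u ≠ 0 ∧ l • u ∈ U := by
  let σ : X →ₗ[F] X := (LinearMap.lsmul E X l).restrictScalars F
  have hσ : Function.Injective σ := smul_right_injective X hl
  -- `U` and its preimage under multiplication by `l` have equal dimension, more than half of the
  -- whole, so they meet.
  have h1 : finrank F (U.comap σ) = finrank F U := by
    have h2 : (U.comap σ).map σ = U :=
      Submodule.map_comap_eq_of_surjective (LinearMap.injective_iff_surjective.1 hσ) U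
    rw [(Submodule.equivMapOfInjective σ hσ (U.comap σ)).finrank_eq, h2]
  have h3 := Submodule.finrank_sup_add_finrank_inf_eq U (U.comap σ)
  have h4 := Submodule.finrank_le (U ⊔ U.comap σ)
  have h5 : U ⊓ U.comap σ ≠ ⊥ := by
    intro h
    rw [h, finrank_bot] at h3
    omega
  obtain ⟨u, hu, hu0⟩ := Submodule.exists_mem_ne_zero_of_ne_bot h5
  exact ⟨u, hu.1, hu0, hu.2⟩

theorem finrank_map_add_le {A B : Type*} [AddCommGroup A] [Module F A] [AddCommGroup B]
    [Module F B] [FiniteDimensional F A] (U K : Submodule F A) (hK : K ≤ U) (π : A →ₗ[F] B)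
    (hπ : ∀ x ∈ K, π x = 0) : finrank F (U.map π) + finrank F K ≤ finrank F U := by
  have h1 := (π.domRestrict U).finrank_range_add_finrank_ker
  rw [LinearMap.range_domRestrict] at h1
  rw [← h1]
  refine Nat.add_le_add_left ?_ _
  refine LinearMap.finrank_le_finrank_of_injective
    (f := (Submodule.inclusion hK).codRestrict (LinearMap.ker (π.domRestrict U))
      fun x => hπ x x.2) ?_
  intro x y hxy
  exact Subtype.ext (congrArg (fun z => (z.1 : A)) hxy)

/-- Over a cubic extension, a subspace which is a cutting blocking set has at least twice the
dimension of the ambient space. -/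
theorem two_mul_finrank_le_of_isCutting [FiniteDimensional F E] [Finite E]
    (hm : finrank F E = 3) (n : ℕ) :
    ∀ {X : Type*} [AddCommGroup X] [Module E X] [Module F X] [IsScalarTower F E X],
      finrank E X = n + 2 → ∀ U : Submodule F X,
      IsCuttingBlockingSet E 1 (U : Set X) → 2 * (n + 2) ≤ finrank F U := by
  induction n with
  | zero =>
    intro X _ _ _ _ hX U hU
    have := finrank_lt_of_isCutting_of_finrank_eq_two hX hU
    omega
  | succ n ih =>
    intro X _ _ _ _ hX U hU
    have : FiniteDimensional E X := FiniteDimensional.of_finrank_pos (by omega)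
    have : FiniteDimensional F X := Module.Finite.trans E X
    by_contra! hlt
    have hFX : finrank F X = 3 * (n + 3) := by
      rw [← Module.finrank_mul_finrank F E X, hm, hX]
    -- Projection from the point `u`: the image of `U` is cutting in dimension `n + 2`, and `K` is
    -- lost in the kernel.
    have key : ∀ u ∈ U, u ≠ 0 → ∀ K : Submodule F X, K ≤ U →
        K ≤ (Submodule.span E {u}).restrictScalars F → 2 * (n + 2) + finrank F K ≤ finrank F U := by
      intro u hu hu0 K hKU hKu
      have h1 : finrank E (X ⧸ Submodule.span E {u}) = n + 2 := by
        have := (Submodule.span E {u}).finrank_quotient_add_finrank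
        rw [finrank_span_singleton hu0, hX] at this
        omega
      let π : X →ₗ[F] X ⧸ Submodule.span E {u} := (Submodule.span E {u}).mkQ.restrictScalars F
      have h2 := ih h1 (U.map π) (hU.image (Submodule.mkQ_surjective (Submodule.span E {u})))
      have h3 := finrank_map_add_le U K hKU π fun x hx =>
        (Submodule.Quotient.mk_eq_zero _).2 (hKu hx)
      omega
    -- A one-dimensional `K` already gives `dim U ≥ 2n + 5`; excluding equality takes a
    -- two-dimensional `K`.
    rcases Nat.lt_or_ge (finrank F U) (2 * n + 5) with h | h
    · obtain ⟨f, hf⟩ : ∃ f : Dual E X, f ≠ 0 := by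
        have : Nontrivial X := Module.nontrivial_of_finrank_pos (R := E) (by omega)
        exact exists_ne 0
      obtain ⟨u, hu, hfu⟩ := hU.exists_ne_zero (by omega) hf
      have hu0 : u ≠ 0 := by
        rintro rfl
        simp at hfu
      have := key u hu hu0 (Submodule.span F {u}) ((Submodule.span_singleton_le_iff_mem _ _).2 hu)
        ((Submodule.span_singleton_le_iff_mem _ _).2 (Submodule.mem_span_singleton_self u))
      rw [finrank_span_singleton hu0] at this
      omega
    · obtain ⟨l, hl⟩ : ∃ l : E, l ∉ Set.range (algebraMap F E) := by
        by_contra! hall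
        have h1 := Subalgebra.bot_eq_top_iff_finrank_eq_one.1
          (top_unique fun x _ => Algebra.mem_bot.2 (hall x) : (⊥ : Subalgebra F E) = ⊤)
        omega
      have hl0 : l ≠ 0 := by
        rintro rfl
        exact hl ⟨0, map_zero _⟩
      -- The dimension condition holds because `2(2n + 5) > 3(n + 3)`.
      obtain ⟨u, hu, hu0, hlu⟩ := exists_mem_smul_mem (U := U) (by omega) hl0
      have hind : LinearIndependent F ![u, l • u] := by
        rw [LinearIndependent.pair_iff' hu0]
        intro a ha
        refine hl ⟨a, ?_⟩
        rw [← algebraMap_smul E a u] at ha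
        exact smul_left_injective E hu0 ha
      have := key u hu hu0 (Submodule.span F (Set.range ![u, l • u])) (Submodule.span_le.2 (by
          rintro _ ⟨i, rfl⟩
          fin_cases i
          exacts [hu, hlu])) (Submodule.span_le.2 (by
          rintro _ ⟨i, rfl⟩
          fin_cases i
          exacts [Submodule.mem_span_singleton_self u,
            Submodule.smul_mem _ l (Submodule.mem_span_singleton_self u)]))
      rw [finrank_span_eq_card hind, Fintype.card_fin] at this
      omega

end Cubic

/-! ### Minimal codes and cutting subspaces. -/

section Correspondence

variable {F E : Type*} [Field F] [Field E] [Algebra F E]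

/-- The `F`-linear combinations of the entries of `α` which vanish. -/
def relations (F : Type*) {E : Type*} [Field F] [Field E] [Algebra F E] {n : ℕ}
    (α : Fin n → E) : Submodule F (Fin n → F) :=
  LinearMap.ker (Fintype.linearCombination F α)

theorem mem_relations {n : ℕ} {α : Fin n → E} {a : Fin n → F} :
    a ∈ relations F α ↔ ∑ j, a j • α j = 0 := by
  rw [relations, LinearMap.mem_ker, Fintype.linearCombination_apply]

theorem relations_le_smul {n : ℕ} (α : Fin n → E) (c : E) :
    relations F α ≤ relations F (c • α) := by
  intro a ha
  rw [mem_relations] at ha ⊢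
  simp only [Pi.smul_apply, smul_comm _ c, ← Finset.smul_sum, ha, smul_zero]

variable {X : Type*} [AddCommGroup X] [Module E X] [Module F X] [IsScalarTower F E X]

/-- The dictionary between both sides: relations of a word are the points of the `F`-span of `b`
lying on the hyperplane. -/
theorem mem_relations_apply {n : ℕ} {b : Fin n → X} {f : Dual E X} {a : Fin n → F} :
    a ∈ relations F (fun j => f (b j)) ↔ f (∑ j, a j • b j) = 0 := by
  rw [mem_relations, map_sum]
  simp only [LinearMap.map_smul_of_tower]

variable [FiniteDimensional F E]

theorem mem_relations_iff_forall_row {n : ℕ} {α : Fin n → E} {a : Fin n → F} :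
    a ∈ relations F α ↔ ∀ i, ∑ j, a j * (coordMatrix (finBasis F E) α).row i j = 0 := by
  rw [mem_relations, ← (finBasis F E).repr.map_eq_zero_iff, Finsupp.ext_iff]
  simp [coordMatrix, Matrix.row, Finset.sum_apply']

theorem exists_span_singleton_of_finrank_eq_one {V : Type*} [AddCommGroup V] [Module E V]
    {D : Submodule E V} (hD : finrank E D = 1) : ∃ v : V, v ≠ 0 ∧ D = Submodule.span E {v} := by
  obtain ⟨v, hv0, hv⟩ := finrank_eq_one_iff'.1 hD
  refine ⟨v, fun h => hv0 (Subtype.ext h), le_antisymm (fun w hw => ?_) ?_⟩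
  · obtain ⟨c, hc⟩ := hv ⟨w, hw⟩
    exact Submodule.mem_span_singleton.2 ⟨c, congrArg Subtype.val hc⟩
  · exact (Submodule.span_singleton_le_iff_mem _ _).2 v.2

theorem sum_mul_eq_zero_of_mem_rsupp {n : ℕ} {α : Fin n → E} {a r : Fin n → F}
    (ha : a ∈ relations F α) (hr : r ∈ rsupp F α) : ∑ j, a j * r j = 0 := by
  rw [mem_relations_iff_forall_row] at ha
  have hle : rsupp F α ≤ LinearMap.ker (Fintype.linearCombination F a) := by
    refine Submodule.span_le.2 ?_
    rintro _ ⟨i, rfl⟩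
    rw [SetLike.mem_coe, LinearMap.mem_ker, Fintype.linearCombination_apply, ← ha i]
    simp only [smul_eq_mul, mul_comm]
  have := hle hr
  rw [LinearMap.mem_ker, Fintype.linearCombination_apply] at this
  rw [← this]
  simp only [smul_eq_mul, mul_comm]

/-- The relations form the orthogonal of the rank support for the standard bilinear form on `F^n`,
and taking orthogonals reverses inclusions in both directions. -/
theorem rsupp_le_rsupp_iff {n : ℕ} {α β : Fin n → E} :
    rsupp F α ≤ rsupp F β ↔ relations F β ≤ relations F α := by
  constructor
  · intro h a ha
    rw [mem_relations_iff_forall_row]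
    intro i
    exact sum_mul_eq_zero_of_mem_rsupp ha (h (Submodule.subset_span ⟨i, rfl⟩))
  · intro h r hr
    by_contra hrβ
    obtain ⟨φ, hφr, hφ⟩ := Submodule.exists_le_ker_of_notMem hrβ
    have hsum : ∀ s : Fin n → F, φ s = ∑ j, φ (Pi.single j 1) * s j := by
      intro s
      conv_lhs => rw [LinearMap.pi_apply_eq_sum_univ φ s]
      refine Finset.sum_congr rfl fun j _ => ?_
      rw [smul_eq_mul, mul_comm]
      congr 2
      ext i
      simp [Pi.single_apply, eq_comm]
    have ha : (fun j => φ (Pi.single j 1)) ∈ relations F β := by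
      rw [mem_relations_iff_forall_row]
      intro i
      rw [← hsum]
      exact hφ (Submodule.subset_span ⟨i, rfl⟩)
    apply hφr
    rw [hsum]
    exact sum_mul_eq_zero_of_mem_rsupp (h ha) hr

theorem rankSupport_span_singleton {n : ℕ} (α : Fin n → E) :
    rankSupport F (Submodule.span E {α} : Set (Fin n → E)) = rsupp F α := by
  apply le_antisymm
  · refine Submodule.span_le.2 (Set.iUnion₂_subset fun β hβ => ?_)
    obtain ⟨c, rfl⟩ := Submodule.mem_span_singleton.1 hβ
    exact rsupp_le_rsupp_iff.2 (relations_le_smul α c)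
  · intro r hr
    exact Submodule.subset_span
      (Set.mem_iUnion₂.2 ⟨α, Submodule.mem_span_singleton_self α, hr⟩)

/-- Minimality of a code in terms of the relations of its nonzero words. -/
theorem isMinimalCode_one_iff {n : ℕ} {C : Submodule E (Fin n → E)} :
    IsMinimalCode F 1 C ↔ ∀ α ∈ C, ∀ β ∈ C, α ≠ 0 → β ≠ 0 →
      relations F β ≤ relations F α → relations F α ≤ relations F β := by
  constructor
  · intro h α hα β hβ hα0 hβ0 hle
    have hs := h (Submodule.span E {β}) ((Submodule.span_singleton_le_iff_mem _ _).2 hβ)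
      (finrank_span_singleton hβ0) (Submodule.span E {α})
      ((Submodule.span_singleton_le_iff_mem _ _).2 hα)
      (by rw [finrank_span_singleton hα0, finrank_span_singleton hβ0])
    rw [rankSupport_span_singleton, rankSupport_span_singleton] at hs
    exact rsupp_le_rsupp_iff.1 (hs (rsupp_le_rsupp_iff.2 hle)).ge
  · intro h D hD hD1 B hB hB1 hle
    rw [hD1] at hB1
    obtain ⟨β, hβ0, rfl⟩ := exists_span_singleton_of_finrank_eq_one hD1
    obtain ⟨α, hα0, rfl⟩ := exists_span_singleton_of_finrank_eq_one hB1
    rw [rankSupport_span_singleton, rankSupport_span_singleton] at hle ⊢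
    refine le_antisymm hle (rsupp_le_rsupp_iff.2 ?_)
    exact h α (hB (Submodule.mem_span_singleton_self α)) β
      (hD (Submodule.mem_span_singleton_self β)) hα0 hβ0 (rsupp_le_rsupp_iff.1 hle)

/-- A cutting blocking set which is a subspace of dimension `d` gives a minimal code of length
`d`. -/
theorem mem_minimalCodeLengths_of_isCutting [FiniteDimensional E X] (hX : 2 ≤ finrank E X)
    {U : Submodule F X} (hU : IsCuttingBlockingSet E 1 (U : Set X)) :
    finrank F U ∈ minimalCodeLengths F E (finrank E X) 1 := by
  have : FiniteDimensional F X := Module.Finite.trans E X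
  let b := finBasis F U
  let c : Dual E X →ₗ[E] (Fin (finrank F U) → E) :=
    LinearMap.pi fun j => Dual.eval E X (b j : X)
  have hc : ∀ f, c f = fun j => f (b j : X) := fun f => rfl
  have hcomb : ∀ u ∈ U, ∃ a : Fin (finrank F U) → F, ∑ j, a j • (b j : X) = u := by
    intro u hu
    refine ⟨b.repr ⟨u, hu⟩, ?_⟩
    have := congrArg U.subtype (b.sum_repr ⟨u, hu⟩)
    rw [map_sum] at this
    exact this
  have hcinj : Function.Injective c := by
    refine (injective_iff_map_eq_zero c).2 fun f hf => ?_
    by_contra hf0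
    obtain ⟨u, hu, hfu⟩ := hU.exists_ne_zero hX hf0
    obtain ⟨a, rfl⟩ := hcomb u hu
    refine hfu (mem_relations_apply.1 ?_)
    rw [← hc, hf, mem_relations]
    simp
  refine ⟨?_, LinearMap.range c, ?_, ?_⟩
  · have : Nontrivial X := Module.nontrivial_of_finrank_pos (R := E) (by omega)
    obtain ⟨f, hf⟩ := exists_ne (0 : Dual E X)
    obtain ⟨u, hu, hfu⟩ := hU.exists_ne_zero hX hf
    refine Module.finrank_pos_iff_exists_ne_zero.2 ⟨⟨u, hu⟩, ?_⟩
    intro h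
    refine hfu ?_
    rw [show u = 0 from congrArg Subtype.val h, map_zero]
  · rw [LinearMap.finrank_range_of_inj hcinj, Subspace.dual_finrank_eq]
  · rw [isMinimalCode_one_iff]
    rintro _ ⟨g, rfl⟩ _ ⟨f, rfl⟩ hg hf hle a ha
    have hk := hU.ker_eq (f := f) (g := g) (by rintro rfl; simp at hf)
      (by rintro rfl; simp at hg) fun u hu hfu => by
        obtain ⟨a, rfl⟩ := hcomb u hu
        exact mem_relations_apply.1 (hle (mem_relations_apply.2 hfu))
    rw [hc, mem_relations_apply] at ha ⊢
    have : ∑ j, a j • (b j : X) ∈ LinearMap.ker f := by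
      rw [hk]
      exact ha
    exact this

/-- The columns of a generator matrix of a minimal code span a cutting blocking set. -/
theorem exists_isCutting_of_isMinimalCode {n : ℕ} {C : Submodule E (Fin n → E)}
    (hC : IsMinimalCode F 1 C) :
    ∃ U : Submodule F (Fin (finrank E C) → E),
      IsCuttingBlockingSet E 1 (U : Set (Fin (finrank E C) → E)) ∧ finrank F U ≤ n := by
  let p : Fin n → Dual E C := fun j => LinearMap.proj j ∘ₗ C.subtype
  have hcut : IsCuttingBlockingSet E 1 (Submodule.span F (Set.range p) : Set (Dual E C)) := by
    by_contra hne
    obtain ⟨f', g', hfg, h⟩ := exists_linearIndependent_of_not_cutting hne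
    -- By biduality, functionals on the dual of `C` are words of `C`.
    obtain ⟨β, rfl⟩ := (evalEquiv E C).surjective f'
    obtain ⟨α, rfl⟩ := (evalEquiv E C).surjective g'
    have hβ : β ≠ 0 := by
      rintro rfl
      exact hfg.ne_zero 0 (by simp)
    have hβ' : (β : Fin n → E) ≠ 0 := fun h => hβ (Subtype.ext h)
    obtain ⟨j, hj⟩ := Function.ne_iff.1 hβ'
    have happ : ∀ γ : C, (γ : Fin n → E) = fun j => evalEquiv E C γ (p j) := fun γ => rfl
    have hspan : ∀ a : Fin n → F, ∑ j, a j • p j ∈ Submodule.span F (Set.range p) := fun a =>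
      Submodule.sum_mem _ fun j _ => Submodule.smul_mem _ _ (Submodule.subset_span ⟨j, rfl⟩)
    -- `t` cancels entry `j`. The word `γ` keeps all relations of `β` and gains the `j`-th unit
    -- vector, which is no relation of `β` as `β j ≠ 0`; this contradicts minimality.
    let t : E := -(α : Fin n → E) j / (β : Fin n → E) j
    let γ : C := α + t • β
    have hγj : (γ : Fin n → E) j = 0 := by
      have hj' : (β : Fin n → E) j ≠ 0 := hj
      simp [γ, t, hj']
    have hγ : (γ : Fin n → E) ≠ 0 := by
      intro h0
      have h1 : α + t • β = 0 := Subtype.ext h0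
      have h2 := (LinearIndependent.pair_iff.1 hfg t 1 (by
        rw [one_smul, ← map_smul, ← map_add, add_comm, h1, map_zero])).2
      exact one_ne_zero h2
    have hle : relations F (β : Fin n → E) ≤ relations F (γ : Fin n → E) := by
      intro a ha
      rw [happ, mem_relations_apply] at ha ⊢
      have h1 := h _ (hspan a) ha
      simp only [γ, map_add, map_smul, LinearMap.add_apply, LinearMap.smul_apply, ha, h1,
        smul_zero, add_zero]
    have hge := isMinimalCode_one_iff.1 hC _ γ.2 _ β.2 hγ hβ' hle
    have h1 : Pi.single j 1 ∈ relations F (γ : Fin n → E) := by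
      rw [mem_relations, Finset.sum_eq_single j (fun i _ hi => by simp [hi]) (by simp)]
      simp [hγj]
    have h2 := hge h1
    rw [mem_relations, Finset.sum_eq_single j (fun i _ hi => by simp [hi]) (by simp)] at h2
    exact hj (by simpa using h2)
  let e : Dual E C ≃ₗ[E] (Fin (finrank E C) → E) :=
    LinearEquiv.ofFinrankEq _ _ (by rw [Subspace.dual_finrank_eq, finrank_fin_fun])
  refine ⟨(Submodule.span F (Set.range p)).map (e.toLinearMap.restrictScalars F), ?_, ?_⟩
  · exact hcut.image (π := e.toLinearMap) e.surjective
  · refine (Submodule.finrank_map_le _ _).trans ?_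
    have := finrank_range_le_card (R := F) p
    rwa [Fintype.card_fin] at this

end Correspondence

end RankMetric

theorem corollary5p4 (F E : Type*) [Field F] [Field E] [Algebra F E] [FiniteDimensional F E]
    [Finite E] :
    -- `ϖ(k, 1)` is also the minimal length of the `k`-dimensional minimal rank metric codes
    (∀ k : ℕ, 2 ≤ k →
      IsLeast (RankMetric.minimalCodeLengths F E k 1) (RankMetric.varpi F E k 1)) ∧
    (∀ k : ℕ, 2 ≤ k → RankMetric.varpi F E k 1 ≤ Module.finrank F E + 2 * k - 3) ∧
    (Module.finrank F E = 3 → ∀ k : ℕ, 2 ≤ k →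
      RankMetric.varpi F E k 1 = 2 * k ∧
      IsLeast (RankMetric.minimalCodeLengths F E k 1) (2 * k)) := by
  have hdim : ∀ k : ℕ, Module.finrank E (Fin k → E) = k := fun k => Module.finrank_fin_fun E
  have h1 : ∀ k : ℕ, 2 ≤ k →
      IsLeast (RankMetric.minimalCodeLengths F E k 1) (RankMetric.varpi F E k 1) := by
    intro k hk
    constructor
    · obtain ⟨U, hU, hd⟩ := (RankMetric.varpi_isLeast F E k 1).1
      have := RankMetric.mem_minimalCodeLengths_of_isCutting (by rwa [hdim]) hU
      rwa [hd, hdim] at this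
    · rintro n ⟨-, C, rfl, hC⟩
      obtain ⟨U, hU, hn⟩ := RankMetric.exists_isCutting_of_isMinimalCode hC
      exact ((RankMetric.varpi_isLeast F E _ 1).2 ⟨U, hU, rfl⟩).trans hn
  have h2 : ∀ k : ℕ, 2 ≤ k →
      RankMetric.varpi F E k 1 ≤ Module.finrank F E + 2 * k - 3 := by
    intro k hk
    have hpos : 0 < Module.finrank F E := Module.finrank_pos
    rcases Nat.lt_or_ge (Module.finrank F E) 2 with hm | hm
    -- For `m = 1` the counting does not apply, but the whole space has dimension `k ≤ 2k - 2`.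
    · refine ((RankMetric.varpi_isLeast F E k 1).2
        ⟨⊤, fun V _ => by simp, rfl⟩).trans ?_
      rw [finrank_top, ← Module.finrank_mul_finrank F E, hdim]
      have : Module.finrank F E = 1 := by omega
      rw [this]
      omega
    · obtain ⟨u, hu⟩ := RankMetric.exists_isCuttingBlockingSet_span (X := Fin k → E) hm
        (by rwa [hdim])
      refine ((RankMetric.varpi_isLeast F E k 1).2 ⟨_, hu, rfl⟩).trans ?_
      have := finrank_range_le_card (R := F) u
      rw [Fintype.card_fin] at this
      exact this.trans_eq (by rw [hdim])
  refine ⟨h1, h2, fun hm k hk => ?_⟩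
  have h3 : RankMetric.varpi F E k 1 = 2 * k := by
    apply le_antisymm
    · have := h2 k hk
      omega
    · obtain ⟨U, hU, hd⟩ := (RankMetric.varpi_isLeast F E k 1).1
      have := RankMetric.two_mul_finrank_le_of_isCutting hm (k - 2)
        (by rw [hdim]; omega) U hU
      omega
  exact ⟨h3, h3 ▸ h1 k hk⟩
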